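/- **Theorem.** Assume $\operatorname{cf}(2^{\aleph_0})=\aleph_1$. Let $(P,\le)$ be a preordered set (a forcing notion; $q\le p$ means that $q$ extends $p$) such that - $P$ is non-trivial: it is non-empty and every $p\in P$ has two extensions $q,r\le p$ that are incompatible, i.e. have no common extension; - $P$ is $\aleph_1$-closed: every decreasing sequence of conditions of length less than $\omega_1$ has a lower bound in $P$; - $|P|\le 2^{\aleph_0}$. Then $P$ is forcing equivalent to $\operatorname{Add}(\aleph_1,1)$, the set of all partial functions from $\omega_1$ to $\{0,1\}$ with domain of size less than $\aleph_1$, ordered by reverse inclusion. Here two forcing notions are forcing equivalent if their Boolean completions are isomorphic, where the Boolean completion $RO(P)$ is the Boolean algebra of regular open subsets of $P$, the open sets being the downward closed ones. -/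

import Mathlib

open scoped Cardinal

noncomputable section

namespace Forcing

/-- Two conditions are compatible if they have a common extension (`p ≤ q` reads "`p` extends `q`",
that is, `p` is the stronger condition). -/
def Compatible {P : Type*} [Preorder P] (p q : P) : Prop :=
  ∃ r : P, r ≤ p ∧ r ≤ q

/-- A forcing notion is non-trivial if it is non-empty and every condition has two incompatible
extensions. -/
def IsNontrivial (P : Type*) [Preorder P] : Prop :=
  Nonempty P ∧ ∀ p : P, ∃ q r : P, q ≤ p ∧ r ≤ p ∧ ¬ Compatible q r

/-- `P` is `κ`-closed if every decreasing sequence of conditions indexed by an ordinal `α < κ` has a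
lower bound in `P`. -/
def IsClosedForcing (κ : Cardinal.{0}) (P : Type*) [Preorder P] : Prop :=
  ∀ α : Ordinal.{0}, α < κ.ord → ∀ f : Set.Iio α → P, Antitone f → ∃ q : P, ∀ i, q ≤ f i

/-- The Boolean completion `RO(P)`: the (complete) Boolean algebra of regular open subsets of `P`,
where the open sets are the downward closed ones. Mathlib's `Heyting.Regular` is the Boolean algebra
of the elements `U` with `Uᶜᶜ = U` (`ᶜ` being the pseudocomplement, the interior of the set-theoretic
complement). -/
abbrev BooleanCompletion (P : Type*) [Preorder P] : Type _ :=
  Heyting.Regular (LowerSet P)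

/-- The pseudocomplement of an open set `U` consists of the conditions with no extension in `U`. -/
theorem mem_compl_iff {P : Type*} [Preorder P] (U : LowerSet P) (p : P) :
    p ∈ Uᶜ ↔ ∀ q ≤ p, q ∉ U := by
  rw [← LowerSet.Iic_le, le_compl_iff_disjoint_right, disjoint_iff_inf_le]
  constructor
  · intro h q hq hU
    have h2 : q ∈ (⊥ : LowerSet P) := h ⟨hq, hU⟩
    exact h2
  · rintro h q ⟨hq, hU⟩
    exact absurd hU (h q hq)

/-- An open set is regular iff it contains each condition below which it is dense. -/
theorem isRegular_iff {P : Type*} [Preorder P] (U : LowerSet P) :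
    Heyting.IsRegular U ↔ ∀ p : P, (∀ q ≤ p, ∃ r ≤ q, r ∈ U) → p ∈ U := by
  have key : ∀ p, p ∈ Uᶜᶜ ↔ ∀ q ≤ p, ∃ r ≤ q, r ∈ U := by
    intro p
    simp only [mem_compl_iff, not_forall, not_not, exists_prop]
  constructor
  · intro h p hp
    rw [← h.eq]
    exact (key p).2 hp
  · intro h
    exact le_antisymm (fun p hp => h p ((key p).1 hp)) le_compl_compl

/-- Forcing equivalence: the Boolean completions are isomorphic. (Order isomorphisms between Boolean
algebras are the same as isomorphisms of Boolean algebras.) -/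
def ForcingEquivalent (P Q : Type*) [Preorder P] [Preorder Q] : Prop :=
  Nonempty (BooleanCompletion P ≃o BooleanCompletion Q)

/-- The Cohen forcing `Add(κ, 1)`: partial functions from `κ` to `{0, 1}` with domain of size less
than `κ`. A partial function is a total function to `Option Bool`, undefined where its value is
`none`. -/
def AddOne (κ : Cardinal.{0}) : Type :=
  {p : κ.ord.ToType → Option Bool // #{a // p a ≠ none} < κ}

/-- Conditions of `Add(κ, 1)` are ordered by reverse inclusion of graphs: `p ≤ q` iff `q ⊆ p`. -/
instance (κ : Cardinal.{0}) : PartialOrder (AddOne κ) where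
  le p q := ∀ a b, q.1 a = some b → p.1 a = some b
  le_refl _ _ _ h := h
  le_trans _ _ _ h₁ h₂ a b h := h₁ a b (h₂ a b h)
  le_antisymm p q h₁ h₂ := Subtype.ext <| funext fun a =>
    Option.ext fun b => ⟨h₂ a b, h₁ a b⟩

end Forcing

end

/-! The plan is to embed one fixed tree, that of sequences of countable successor length in Cantor
space, densely into every `P` satisfying the hypotheses. `Add(ℵ₁, 1)` satisfies them as well, so
both completions are isomorphic to that of the tree.

The embedding is built by recursion on levels: above a branch already embedded, let `L` be the open
set of its lower bounds, and index a maximal antichain of `L` by Cantor space. The cofinality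
assumption writes `P` as a union of `ℵ₁` many sets `Q a` of size less than continuum, and the
antichain at level `a` is chosen with an element below each `p ∈ Q a` that has an extension in `L`
(`exists_refining_antichain`, which rests on disjoint refinement). For density, closure and
maximality yield a branch along which `p ∈ Q a` always has an extension; at level `a` some node then
lies below `p`. -/

noncomputable section

namespace Forcing

open Set

universe u v

/-! ### Dense embeddings and forcing equivalence -/

section General

variable {P : Type u} {Q : Type v} [Preorder P] [Preorder Q]

theorem Compatible.refl (p : P) : Compatible p p := ⟨p, le_rfl, le_rfl⟩

theorem Compatible.symm {p q : P} : Compatible p q → Compatible q p :=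
  fun ⟨r, h₁, h₂⟩ => ⟨r, h₂, h₁⟩

theorem Compatible.mono {p q p' q' : P} (h : Compatible p q) (hp : p ≤ p') (hq : q ≤ q') :
    Compatible p' q' :=
  let ⟨r, h₁, h₂⟩ := h
  ⟨r, h₁.trans hp, h₂.trans hq⟩

theorem ForcingEquivalent.symm (h : ForcingEquivalent P Q) : ForcingEquivalent Q P :=
  h.map OrderIso.symm

theorem ForcingEquivalent.trans {R : Type*} [Preorder R] (h : ForcingEquivalent P Q)
    (h' : ForcingEquivalent Q R) : ForcingEquivalent P R :=
  let ⟨f⟩ := h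
  let ⟨g⟩ := h'
  ⟨f.trans g⟩

/-- A dense embedding: a monotone map that preserves incompatibility and has dense range. -/
structure IsDenseEmbedding (e : Q → P) : Prop where
  monotone : Monotone e
  compatible : ∀ s t, Compatible (e s) (e t) → Compatible s t
  dense : ∀ p, ∃ t, e t ≤ p

/-- The preimage of a regular open set under a dense embedding. -/
def IsDenseEmbedding.comap {e : Q → P} (he : IsDenseEmbedding e) (U : BooleanCompletion P) :
    BooleanCompletion Q :=
  ⟨⟨e ⁻¹' (U : LowerSet P), fun _ _ h hU => (U : LowerSet P).lower (he.monotone h) hU⟩, by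
    rw [isRegular_iff]
    intro t ht
    refine (isRegular_iff _).1 U.2 _ fun q hq => ?_
    obtain ⟨t₁, ht₁⟩ := he.dense q
    -- `e` need not reflect the order: `e t₁ ≤ e t` only gives a common extension of `t₁` and `t`.
    obtain ⟨t₂, h₂, h₂'⟩ := he.compatible t₁ t ⟨e t₁, le_rfl, ht₁.trans hq⟩
    obtain ⟨t₃, h₃, hU⟩ := ht t₂ h₂'
    exact ⟨e t₃, (he.monotone (h₃.trans h₂)).trans ht₁, hU⟩⟩

theorem IsDenseEmbedding.forcingEquivalent {e : Q → P} (he : IsDenseEmbedding e) :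
    ForcingEquivalent P Q := by
  have hle : ∀ U U' : BooleanCompletion P, he.comap U ≤ he.comap U' ↔ U ≤ U' := by
    intro U U'
    constructor
    · intro h p hp
      refine (isRegular_iff _).1 U'.2 _ fun q hq => ?_
      obtain ⟨t, ht⟩ := he.dense q
      have h₁ : t ∈ (he.comap U : LowerSet Q) := (U : LowerSet P).lower (ht.trans hq) hp
      have h₂ : t ∈ (he.comap U' : LowerSet Q) := h h₁
      exact ⟨e t, ht, h₂⟩
    · intro h t ht
      have : e t ∈ (U : LowerSet P) := ht
      exact (show (U : LowerSet P) ≤ U' from h) this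
  refine ⟨RelIso.ofSurjective (OrderEmbedding.ofMapLEIff he.comap hle) fun V => ?_⟩
  have hV := (isRegular_iff _).1 V.2
  -- The preimage of `V` under `he.comap` consists of the conditions below which the image of `V` is
  -- dense.
  let U : LowerSet P := ⟨{p | ∀ q ≤ p, ∃ t ∈ (V : LowerSet Q), e t ≤ q},
    fun _ _ h hU q hq => hU q (hq.trans h)⟩
  have hU : Heyting.IsRegular U := by
    rw [isRegular_iff]
    intro p hp q hq
    obtain ⟨r, hr, hrU⟩ := hp q hq
    obtain ⟨t, ht, htr⟩ := hrU r le_rfl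
    exact ⟨t, ht, htr.trans hr⟩
  refine ⟨⟨U, hU⟩, Subtype.ext (LowerSet.ext (Set.ext fun t => ⟨fun h => ?_, fun h => ?_⟩))⟩
  · refine hV t fun t' ht' => ?_
    obtain ⟨t₁, h₁, h₁'⟩ := h (e t') (he.monotone ht')
    obtain ⟨t₂, h₂, h₂'⟩ := he.compatible t₁ t' ⟨e t₁, le_rfl, h₁'⟩
    exact ⟨t₂, h₂', (V : LowerSet Q).lower h₂ h₁⟩
  · intro q hq
    obtain ⟨t₁, h₁⟩ := he.dense q
    obtain ⟨t₂, h₂, h₂'⟩ := he.compatible t₁ t ⟨e t₁, le_rfl, h₁.trans hq⟩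
    exact ⟨t₂, (V : LowerSet Q).lower h₂' h, (he.monotone h₂).trans h₁⟩

theorem IsDenseEmbedding.of_orderIso (f : Q ≃o P) : IsDenseEmbedding f where
  monotone := f.monotone
  compatible s t := by
    rintro ⟨r, h₁, h₂⟩
    exact ⟨f.symm r, f.symm_apply_le.2 h₁, f.symm_apply_le.2 h₂⟩
  dense p := ⟨f.symm p, by simp⟩

theorem IsNontrivial.of_orderIso (f : P ≃o Q) (h : IsNontrivial P) : IsNontrivial Q := by
  refine ⟨h.1.map f, fun p => ?_⟩
  obtain ⟨q, r, hq, hr, hqr⟩ := h.2 (f.symm p)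
  refine ⟨f q, f r, (f.le_symm_apply).1 hq, (f.le_symm_apply).1 hr, fun hc => hqr ?_⟩
  exact (IsDenseEmbedding.of_orderIso f).compatible _ _ hc

theorem IsClosedForcing.of_orderIso {κ : Cardinal.{0}} (f : P ≃o Q) (h : IsClosedForcing κ P) :
    IsClosedForcing κ Q := by
  intro α hα g hg
  obtain ⟨q, hq⟩ := h α hα (fun i => f.symm (g i)) fun i j hij => f.symm.monotone (hg hij)
  exact ⟨f q, fun i => (f.le_symm_apply).1 (hq i)⟩

end General

/-! ### Transfinite choice and disjoint refinement -/

/-- Dependent choice along a well-order: if every sequence that satisfies the step relation `R`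
below `a` can be extended at `a`, then there is a sequence that satisfies `R` everywhere. -/
theorem exists_forall_step {W : Type u} {X : Type v} [LinearOrder W] [WellFoundedLT W] [Nonempty X]
    (R : W → (W → X) → X → Prop)
    (hR : ∀ a f g x, (∀ b < a, f b = g b) → R a f x → R a g x)
    (h : ∀ a f, (∀ b < a, R b f (f b)) → ∃ x, R a f x) :
    ∃ f, ∀ a, R a f (f a) := by
  classical
  let x₀ : X := Classical.arbitrary X
  let ext (a : W) (prev : ∀ b, b < a → X) : W → X := fun b => if hb : b < a then prev b hb else x₀
  let f : W → X := wellFounded_lt.fix fun a prev => Classical.epsilon (R a (ext a prev))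
  have hf : ∀ a, f a = Classical.epsilon (R a (ext a fun b _ => f b)) := fun a =>
    wellFounded_lt.fix_eq _ a
  have hext : ∀ a, ∀ b < a, ext a (fun b _ => f b) b = f b := fun a b hb => by simp [ext, hb]
  refine ⟨f, fun a => ?_⟩
  induction a using WellFoundedLT.induction with
  | ind a ih =>
    obtain ⟨x, hx⟩ := h a f ih
    have := Classical.epsilon_spec (p := R a (ext a fun b _ => f b))
      ⟨x, hR a _ _ x (fun b hb => (hext a b hb).symm) hx⟩
    rw [← hf] at this
    exact hR a _ _ _ (hext a) this

/-- Sets of size greater than that of the index set have an injective choice function. -/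
theorem exists_injective_choice {ι K : Type u} (X : ι → Set K) (h : ∀ i, #ι < #(X i)) :
    ∃ k : ι → K, Function.Injective k ∧ ∀ i, k i ∈ X i := by
  classical
  rcases isEmpty_or_nonempty ι with hι | ⟨⟨i₀⟩⟩
  · exact ⟨hι.elim, fun i => hι.elim i, fun i => hι.elim i⟩
  obtain ⟨_, _⟩ := exists_wellFoundedLT ι
  have hK : Nonempty K := by
    have h₀ := pos_of_gt (h i₀)
    obtain ⟨x⟩ := Cardinal.mk_ne_zero_iff.1 h₀.ne'
    exact ⟨x⟩
  obtain ⟨k, hk⟩ := exists_forall_step (W := ι) (X := K)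
    (fun i f x => x ∈ X i ∧ ∀ j < i, f j ≠ x)
    (fun i f g x hfg hx => ⟨hx.1, fun j hj => hfg j hj ▸ hx.2 j hj⟩) (by
      intro i f _
      have h₁ : #(f '' Iio i) < #(X i) :=
        (Cardinal.mk_image_le.trans (Cardinal.mk_set_le _)).trans_lt (h i)
      obtain ⟨x, hx, hx'⟩ := Set.not_subset.1 fun hs => h₁.not_ge (Cardinal.mk_le_mk_of_subset hs)
      exact ⟨x, hx, fun j hj hjx => hx' ⟨j, hj, hjx⟩⟩)
  refine ⟨k, fun i j hij => ?_, fun i => (hk i).1⟩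
  rcases lt_trichotomy i j with hlt | heq | hlt
  · exact absurd hij ((hk j).2 i hlt)
  · exact heq
  · exact absurd hij.symm ((hk i).2 j hlt)

/-- The disjoint refinement lemma: if below each `q i` there is an antichain of size greater than
an infinite `μ ≥ #ι`, then some antichain chooses one element below each `q i`. -/
theorem exists_disjoint_refinement {P ι K : Type u} [Preorder P] {μ : Cardinal.{u}}
    (hμ : ℵ₀ ≤ μ) (hι : #ι ≤ μ) (hK : μ < #K) (q : ι → P) (a : ι → K → P)
    (haq : ∀ i k, a i k ≤ q i) (ha : ∀ i k l, Compatible (a i k) (a i l) → k = l) :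
    ∃ d : ι → P, (∀ i, d i ≤ q i) ∧ ∀ i j, Compatible (d i) (d j) → i = j := by
  classical
  obtain ⟨_, _⟩ := exists_wellFoundedLT ι
  let S (i j : ι) : Set K := {k | Compatible (a j k) (q i)}
  have hex : ∀ i, {j | μ < #(S i j)}.Nonempty := by
    intro i
    refine ⟨i, ?_⟩
    have : S i i = univ := eq_univ_of_forall fun k => ⟨a i k, le_rfl, haq i k⟩
    simpa [this] using hK
  -- `d i` will extend both `q i` and a member of the first antichain that meets `q i` in more than
  -- `μ` elements.
  let η (i : ι) : ι := wellFounded_lt.min _ (hex i)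
  have hη : ∀ i, μ < #(S i (η i)) := fun i => wellFounded_lt.min_mem _ (hex i)
  have hη' : ∀ i j, j < η i → #(S i j) ≤ μ := fun i j hj =>
    not_lt.1 fun h => wellFounded_lt.not_lt_min {j | μ < #(S i j)} h hj
  -- Avoiding `B i` separates `d i` from every `d j` with `η i < η j`; minimality of `η j` keeps `B
  -- i` small. When `η i = η j`, both lie below members of one antichain, and injectivity of `k`
  -- separates them.
  let B (i : ι) : Set K := ⋃ j : {j : ι // η i < η j}, S (j : ι) (η i)
  have hB : ∀ i, #(B i) ≤ μ := fun i =>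
    (Cardinal.mk_iUnion_le_sum_mk.trans (Cardinal.sum_le_mk_mul_iSup _)).trans <|
      (mul_le_mul' ((Cardinal.mk_subtype_le _).trans hι)
        (ciSup_le' fun j : {j : ι // η i < η j} => hη' j _ j.2)).trans (Cardinal.mul_eq_self hμ).le
  have hX : ∀ i, #ι < #(S i (η i) \ B i : Set K) := by
    intro i
    refine hι.trans_lt (lt_of_not_ge fun hle => (hη i).not_ge ?_)
    have : S i (η i) ⊆ (S i (η i) \ B i) ∪ B i := by
      rw [sdiff_union_self]
      exact subset_union_left
    exact (Cardinal.mk_le_mk_of_subset this).trans <| (Cardinal.mk_union_le _ _).trans <|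
      (add_le_add hle (hB i)).trans (Cardinal.add_eq_self hμ).le
  obtain ⟨k, hkinj, hk⟩ := exists_injective_choice _ hX
  choose d hd hdq using fun i => (hk i).1
  have hlt : ∀ i j, Compatible (d i) (d j) → ¬ η i < η j := fun i j hc h =>
    (hk i).2 (mem_iUnion.2 ⟨⟨j, h⟩, hc.mono (hd i) (hdq j)⟩)
  refine ⟨d, hdq, fun i j hc => hkinj ?_⟩
  have heq : η i = η j := le_antisymm (not_lt.1 (hlt j i hc.symm)) (not_lt.1 (hlt i j hc))
  refine ha (η i) _ _ (hc.mono (hd i) ?_)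
  rw [heq]
  exact hd j

/-! ### Antichains of size continuum -/

/-- A non-trivial `ℵ₁`-closed forcing notion has an antichain of size continuum below each
condition. -/
theorem exists_antichain_below {P : Type*} [Preorder P] (hn : IsNontrivial P)
    (hc : ∀ f : ℕ → P, Antitone f → ∃ q, ∀ n, q ≤ f n) (p : P) :
    ∃ a : (ℕ → Bool) → P, (∀ x, a x ≤ p) ∧ ∀ x y, Compatible (a x) (a y) → x = y := by
  choose s t hs ht hst using hn.2
  let node (x : ℕ → Bool) (n : ℕ) : P :=
    n.rec p fun n q => bif x n then s q else t q
  have hnode : ∀ x n, node x (n + 1) = bif x n then s (node x n) else t (node x n) :=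
    fun _ _ => rfl
  have hanti : ∀ x, Antitone (node x) := fun x => antitone_nat_of_succ_le fun n => by
    rw [hnode]
    cases x n
    · exact ht _
    · exact hs _
  choose a ha using fun x => hc (node x) (hanti x)
  refine ⟨a, fun x => ha x 0, fun x y hxy => ?_⟩
  funext n
  induction n using Nat.strong_induction_on with
  | _ n ih =>
    have heq : ∀ m ≤ n, node x m = node y m := by
      intro m
      induction m with
      | zero => exact fun _ => rfl
      | succ m ihm =>
        intro hm
        rw [hnode, hnode, ihm (by omega), ih m (by omega)]
    have hcomp := hxy.mono (ha x (n + 1)) (ha y (n + 1))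
    rw [hnode, hnode, heq n le_rfl] at hcomp
    cases hx : x n <;> cases hy : y n <;> simp only [hx, hy, cond_true, cond_false] at hcomp ⊢
    · exact absurd hcomp.symm (hst _)
    · exact absurd hcomp (hst _)

/-- In a non-empty open set there is a maximal antichain of size continuum with an element below
each of fewer than continuum many given conditions that have an extension in the open set. -/
theorem exists_refining_antichain {P : Type} [Preorder P] (hn : IsNontrivial P)
    (hc : ∀ f : ℕ → P, Antitone f → ∃ q, ∀ n, q ≤ f n) (hP : #P ≤ 2 ^ ℵ₀)
    (L : LowerSet P) (hL : ∃ p, p ∈ L) (Q : Set P) (hQ : #Q < 2 ^ ℵ₀) :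
    ∃ w : (ℕ → Bool) → P, (∀ k, w k ∈ L) ∧ (∀ k l, Compatible (w k) (w l) → k = l) ∧
      (∀ q ∈ L, ∃ k, Compatible (w k) q) ∧ ∀ p ∈ Q, (∃ r ≤ p, r ∈ L) → ∃ k, w k ≤ p := by
  choose a hap ha using exists_antichain_below hn hc
  obtain ⟨p₀, hp₀⟩ := hL
  have hKc : #(ℕ → Bool) = 2 ^ ℵ₀ := by simp
  have hcℵ : ℵ₀ < (2 : Cardinal.{0}) ^ ℵ₀ := Cardinal.cantor _
  let Q' : Set P := {p | p ∈ Q ∧ ∃ r ≤ p, r ∈ L}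
  choose r hrp hrL using fun p : Q' => p.2.2
  -- The extra index `none` gives the antichain size continuum even if `Q'` is empty.
  let q : Option Q' → P := fun i => i.elim p₀ r
  have hqL : ∀ i, q i ∈ L := by
    rintro (_ | i)
    · exact hp₀
    · exact hrL i
  have hι : #(Option Q') < 2 ^ ℵ₀ := by
    rw [Cardinal.mk_option]
    refine Cardinal.add_lt_of_lt hcℵ.le ?_ (Cardinal.one_lt_aleph0.trans hcℵ)
    exact (Cardinal.mk_le_mk_of_subset fun _ h => h.1).trans_lt hQ
  obtain ⟨d, hdq, hd⟩ := exists_disjoint_refinement (le_max_left ℵ₀ #(Option Q'))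
    (le_max_right _ _) (hKc ▸ max_lt hcℵ hι) q (fun i => a (q i)) (fun i => hap _)
    fun i => ha _
  -- Splitting each `d i` into continuum many pieces keeps an antichain; Zorn's lemma then makes it
  -- maximal in `L`.
  let D : Set P := range fun x : Option Q' × (ℕ → Bool) => a (d x.1) x.2
  let S : Set (Set P) := {M | M ⊆ L ∧ M.Pairwise fun p q => ¬ Compatible p q}
  have hDS : D ∈ S := by
    constructor
    · rintro _ ⟨x, rfl⟩
      exact L.lower ((hap _ _).trans (hdq _)) (hqL _)
    · rintro _ ⟨x, rfl⟩ _ ⟨y, rfl⟩ hne hcomp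
      have h₁ : x.1 = y.1 := hd _ _ (hcomp.mono (hap _ _) (hap _ _))
      dsimp only at hne hcomp
      rw [h₁] at hcomp hne
      exact hne (by rw [ha _ _ _ hcomp])
  obtain ⟨M, hDM, hM⟩ := zorn_subset_nonempty S (by
    intro C hCS hC _
    refine ⟨⋃₀ C, ⟨sUnion_subset fun s hs => (hCS hs).1, ?_⟩, fun s => subset_sUnion_of_mem⟩
    exact (pairwise_sUnion hC.directedOn).2 fun s hs => (hCS hs).2) D hDS
  have hMcard : #(ℕ → Bool) = #M := by
    refine le_antisymm ?_ ((Cardinal.mk_set_le M).trans (hKc ▸ hP))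
    refine Cardinal.mk_le_of_injective (f := fun k => ⟨a (d none) k, hDM ⟨(none, k), rfl⟩⟩) ?_
    intro k l hkl
    have : a (d none) k = a (d none) l := congrArg Subtype.val hkl
    exact ha (d none) k l (this ▸ Compatible.refl _)
  obtain ⟨φ⟩ := Cardinal.eq.1 hMcard
  refine ⟨fun k => φ k, fun k => hM.1.1 (φ k).2, fun k l h => ?_, fun p hp => ?_, ?_⟩
  · by_contra hkl
    exact hM.1.2 (φ k).2 (φ l).2 (fun h => hkl (φ.injective (Subtype.ext h))) h
  · by_contra! hno
    have hno' : ∀ m ∈ M, ¬ Compatible m p := fun m hm => by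
      simpa using hno (φ.symm ⟨m, hm⟩)
    have hins : insert p M ∈ S := by
      refine ⟨insert_subset hp hM.1.1, ?_⟩
      exact pairwise_insert.2
        ⟨hM.1.2, fun m hm _ => ⟨fun h => hno' m hm h.symm, hno' m hm⟩⟩
    have : p ∈ M := hM.2 hins (subset_insert p M) (mem_insert p M)
    exact hno' p this (Compatible.refl p)
  · intro p hpQ hpL
    let i : Q' := ⟨p, hpQ, hpL⟩
    let k₀ : ℕ → Bool := fun _ => true
    obtain ⟨k, hk⟩ := φ.surjective ⟨a (d (some i)) k₀, hDM ⟨(some i, k₀), rfl⟩⟩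
    refine ⟨k, ?_⟩
    dsimp only
    rw [hk]
    exact (hap _ _).trans ((hdq (some i)).trans (hrp i))

/-! ### The base tree -/

/-- The nodes of the tree of sequences of length `< W` in `K`: the pair `(a, s)` stands for the
restriction of `s` to `Iic a`. -/
structure TreeNode (W K : Type*) where
  level : W
  branch : W → K

instance (W K : Type*) [Preorder W] : Preorder (TreeNode W K) where
  le s t := t.level ≤ s.level ∧ ∀ b ≤ t.level, s.branch b = t.branch b
  le_refl s := ⟨le_rfl, fun _ _ => rfl⟩
  le_trans s t u h₁ h₂ := ⟨h₂.1.trans h₁.1, fun b hb =>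
    (h₁.2 b (hb.trans h₂.1)).trans (h₂.2 b hb)⟩

/-- A base tree: a non-empty forcing notion that is closed along the well-order `W` and covered by
sets `Q a` that are refined by maximal antichains indexed by `K` in each non-empty open set has a
dense embedding from the tree of sequences. -/
theorem exists_isDenseEmbedding_treeNode {P W K : Type*} [Preorder P] [LinearOrder W]
    [WellFoundedLT W] [Nonempty P] [Nonempty K]
    (hclosed : ∀ (a : W) (f : W → P), AntitoneOn f (Iio a) → ∃ q, ∀ b < a, q ≤ f b)
    (Q : W → Set P) (hQ : ∀ p, ∃ a, p ∈ Q a)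
    (hw : ∀ (a : W) (L : LowerSet P), (∃ p, p ∈ L) → ∃ w : K → P, (∀ k, w k ∈ L) ∧
      (∀ k l, Compatible (w k) (w l) → k = l) ∧ (∀ q ∈ L, ∃ k, Compatible (w k) q) ∧
      ∀ p ∈ Q a, (∃ r ≤ p, r ∈ L) → ∃ k, w k ≤ p) :
    ∃ e : TreeNode W K → P, IsDenseEmbedding e := by
  classical
  -- Junk values for empty `L` let the recursion run before `hLne` shows that they never occur.
  have hw' : ∀ (a : W) (L : LowerSet P), ∃ w : K → P, (∃ p, p ∈ L) → (∀ k, w k ∈ L) ∧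
      (∀ k l, Compatible (w k) (w l) → k = l) ∧ (∀ q ∈ L, ∃ k, Compatible (w k) q) ∧
      ∀ p ∈ Q a, (∃ r ≤ p, r ∈ L) → ∃ k, w k ≤ p := by
    intro a L
    by_cases hL : ∃ p, p ∈ L
    · obtain ⟨w, h⟩ := hw a L hL
      exact ⟨w, fun _ => h⟩
    · exact ⟨fun _ => Classical.arbitrary P, fun h => absurd h hL⟩
  choose w hw using hw'
  let low (a : W) (prev : ∀ b, b < a → P) : LowerSet P :=
    ⟨{p | ∀ b (hb : b < a), p ≤ prev b hb}, fun _ _ h hp b hb => h.trans (hp b hb)⟩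
  let e (s : W → K) : W → P := wellFounded_lt.fix fun a prev => w a (low a prev) (s a)
  let L (s : W → K) (a : W) : LowerSet P := low a fun b _ => e s b
  have he : ∀ s a, e s a = w a (L s a) (s a) := fun s a => wellFounded_lt.fix_eq _ a
  have hLcongr : ∀ s t a, (∀ b < a, e s b = e t b) → L s a = L t a := by
    intro s t a h
    refine LowerSet.ext (Set.ext fun p => ?_)
    exact forall₂_congr fun b hb => by dsimp only; rw [h b hb]
  have hecongr : ∀ s t a, (∀ b ≤ a, s b = t b) → e s a = e t a := by
    intro s t a
    induction a using WellFoundedLT.induction with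
    | ind a ih =>
      intro h
      rw [he, he, h a le_rfl,
        hLcongr s t a fun b hb => ih b hb fun c hc => h c (hc.trans hb.le)]
  have hLne : ∀ s a, ∃ p, p ∈ L s a := by
    intro s a
    induction a using WellFoundedLT.induction with
    | ind a ih =>
      refine hclosed a (e s) fun b hb c hc hbc => ?_
      rcases hbc.eq_or_lt with rfl | hbc
      · exact le_rfl
      · rw [he s c]
        exact (hw c (L s c) (ih c hc)).1 _ b hbc
  have hanti : ∀ s, Antitone (e s) := by
    intro s b c hbc
    rcases hbc.eq_or_lt with rfl | hbc
    · exact le_rfl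
    · rw [he s c]
      exact (hw c (L s c) (hLne s c)).1 _ b hbc
  have hagree : ∀ s t a, Compatible (e s a) (e t a) → ∀ b ≤ a, s b = t b := by
    intro s t a hcomp b
    induction b using WellFoundedLT.induction with
    | ind b ih =>
      intro hb
      have h₁ := hcomp.mono (hanti s hb) (hanti t hb)
      rw [he, he, hLcongr t s b fun c hc => hecongr _ _ _ fun d hd =>
        (ih d (hd.trans_lt hc) ((hd.trans hc.le).trans hb)).symm] at h₁
      exact (hw b _ (hLne s b)).2.1 _ _ h₁
  have hupdate : ∀ s a k, e (Function.update s a k) a = w a (L s a) k := by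
    intro s a k
    rw [he, Function.update_self, hLcongr _ s a fun b hb => hecongr _ _ _ fun c hc =>
      Function.update_of_ne (hc.trans_lt hb).ne _ _]
  refine ⟨fun x => e x.branch x.level, fun x y hxy => ?_, fun x y hcomp => ?_, fun p => ?_⟩
  · rw [← hecongr _ _ _ hxy.2]
    exact hanti _ hxy.1
  · rcases le_total x.level y.level with h | h
    · have := hagree x.branch y.branch x.level (hcomp.mono le_rfl (hanti _ h))
      exact ⟨y, ⟨h, fun b hb => (this b hb).symm⟩, le_rfl⟩
    · have := hagree x.branch y.branch y.level (hcomp.mono (hanti _ h) le_rfl)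
      exact ⟨x, le_rfl, h, this⟩
  -- A decreasing sequence below `p` is built together with a branch `s`, its term at `a` lying
  -- below the node of `s` at level `a`.
  · obtain ⟨f, hf⟩ := exists_forall_step (W := W) (X := P × K)
      (fun a f x => x.1 ≤ p ∧ (∀ b < a, x.1 ≤ (f b).1) ∧
        x.1 ≤ e (Function.update (fun b => (f b).2) a x.2) a)
      (by
        rintro a f g x hfg ⟨h₁, h₂, h₃⟩
        refine ⟨h₁, fun b hb => hfg b hb ▸ h₂ b hb, h₃.trans_eq (hecongr _ _ _ fun b hb => ?_)⟩
        rcases hb.eq_or_lt with rfl | hb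
        · simp
        · simp [hb.ne, hfg b hb])
      (by
        intro a f hf
        obtain ⟨q, hqp, hq⟩ : ∃ q, q ≤ p ∧ ∀ b < a, q ≤ (f b).1 := by
          -- At the least level the closure bound says nothing about `p`, so `p` itself is taken.
          by_cases hemp : ∃ b, b < a
          · obtain ⟨q, hq⟩ := hclosed a (fun b => (f b).1) fun b hb c hc hbc => by
              rcases hbc.eq_or_lt with rfl | hbc
              · exact le_rfl
              · exact (hf c hc).2.1 b hbc
            obtain ⟨b, hb⟩ := hemp
            exact ⟨q, (hq b hb).trans (hf b hb).1, hq⟩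
          · exact ⟨p, le_rfl, fun b hb => absurd ⟨b, hb⟩ hemp⟩
        let s : W → K := fun b => (f b).2
        have hqL : q ∈ L s a := fun b hb => by
          have := (hq b hb).trans (hf b hb).2.2
          rwa [Function.update_eq_self_iff.2 rfl] at this
        obtain ⟨k, r, hrk, hrq⟩ := (hw a (L s a) (hLne s a)).2.2.1 q hqL
        exact ⟨(r, k), hrq.trans hqp, fun b hb => hrq.trans (hq b hb), by rwa [hupdate]⟩)
    let s : W → K := fun b => (f b).2
    obtain ⟨a, ha⟩ := hQ p
    have hmem : (f a).1 ∈ L s a := fun b hb => by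
      have := ((hf a).2.1 b hb).trans (hf b).2.2
      rwa [Function.update_eq_self_iff.2 rfl] at this
    obtain ⟨k, hk⟩ := (hw a (L s a) (hLne s a)).2.2.2 p ha ⟨_, (hf a).1, hmem⟩
    exact ⟨⟨a, Function.update s a k⟩, by rwa [hupdate]⟩

/-! ### Application to `ℵ₁`-closed forcing notions -/

/-- The tree of sequences of countable successor length in Cantor space. -/
abbrev ContinuumTree : Type := TreeNode (Cardinal.aleph.{0} 1).ord.ToType (ℕ → Bool)

theorem IsClosedForcing.exists_lower_bound_nat {P : Type*} [Preorder P]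
    (h : IsClosedForcing (Cardinal.aleph 1) P) (f : ℕ → P) (hf : Antitone f) :
    ∃ q, ∀ n, q ≤ f n := by
  have hω : Ordinal.omega0.{0} < (Cardinal.aleph.{0} 1).ord := by
    rw [← Cardinal.ord_aleph0, Cardinal.ord_lt_ord]
    exact Cardinal.aleph0_lt_aleph_one
  choose n hn using fun i : Iio Ordinal.omega0.{0} => Ordinal.lt_omega0.1 i.2
  obtain ⟨q, hq⟩ := h _ hω (fun i => f (n i)) fun i j hij => hf <| by
    have : (i : Ordinal) ≤ j := hij
    rw [hn i, hn j] at this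
    exact_mod_cast this
  refine ⟨q, fun m => ?_⟩
  have := hq ⟨m, Ordinal.natCast_lt_omega0 m⟩
  have hm : n ⟨m, Ordinal.natCast_lt_omega0 m⟩ = m := by
    have h' : (m : Ordinal) = n ⟨m, Ordinal.natCast_lt_omega0 m⟩ := hn ⟨m, _⟩
    exact_mod_cast h'.symm
  rwa [hm] at this

theorem IsClosedForcing.exists_lower_bound_toType {κ : Cardinal.{0}} {P : Type*} [Preorder P]
    (h : IsClosedForcing κ P) (a : κ.ord.ToType) (f : κ.ord.ToType → P)
    (hf : AntitoneOn f (Iio a)) : ∃ q, ∀ b < a, q ≤ f b := by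
  let φ : Iio κ.ord ≃o κ.ord.ToType := Ordinal.ToType.mk
  have hlt : ∀ i : Iio (φ.symm a : Ordinal), (i : Ordinal) < κ.ord :=
    fun i => (mem_Iio.1 i.2).trans (φ.symm a).2
  have hφ : ∀ i : Iio (φ.symm a : Ordinal), φ ⟨i, hlt i⟩ < a := fun i => by
    rw [← φ.lt_symm_apply]
    exact i.2
  obtain ⟨q, hq⟩ := h (φ.symm a) (φ.symm a).2 (fun i => f (φ ⟨i, hlt i⟩))
    fun i j hij => hf (hφ i) (hφ j) (φ.monotone hij)
  refine ⟨q, fun b hb => ?_⟩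
  have := hq ⟨φ.symm b, φ.symm.strictMono hb⟩
  rwa [show φ ⟨φ.symm b, hlt ⟨φ.symm b, φ.symm.strictMono hb⟩⟩ = b from φ.apply_symm_apply b]
    at this

/-- A set of size at most `κ` is the union of `cof κ` many sets of size less than `κ`. -/
theorem exists_cover_of_cof {P : Type} {κ μ : Cardinal.{0}} (hκ : ℵ₀ ≤ κ) (hP : #P ≤ κ)
    (hμ : κ.ord.cof = μ) :
    ∃ Q : μ.ord.ToType → Set P, (∀ p, ∃ a, p ∈ Q a) ∧ ∀ a, #(Q a) < κ := by
  obtain ⟨s, hs, hsμ⟩ := Order.exists_cof_eq κ.ord.ToType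
  rw [Ordinal.cof_toType, hμ, ← Cardinal.mk_ord_toType μ] at hsμ
  obtain ⟨φ⟩ := Cardinal.eq.1 hsμ
  rw [← Cardinal.mk_ord_toType κ] at hP
  obtain ⟨g⟩ := hP
  -- `P` is injected into the initial ordinal of `κ` and cut at the points of a cofinal set of size
  -- `μ`.
  refine ⟨fun a => {p | g p ≤ (φ.symm a : κ.ord.ToType)}, fun p => ?_, fun a => ?_⟩
  · obtain ⟨x, hx, hpx⟩ := hs (g p)
    exact ⟨φ ⟨x, hx⟩, by simpa using hpx⟩
  · have h₁ : #(Iio (φ.symm a : κ.ord.ToType)) < κ := by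
      simpa using Cardinal.mk_Iio_lt (φ.symm a : κ.ord.ToType)
    have h₂ : #(Iic (φ.symm a : κ.ord.ToType)) < κ := by
      rw [← Iio_insert]
      exact (Cardinal.mk_insert_le).trans_lt
        (Cardinal.add_lt_of_lt hκ h₁ (Cardinal.one_lt_aleph0.trans_le hκ))
    refine lt_of_le_of_lt ?_ h₂
    exact Cardinal.mk_le_of_injective (f := fun p => ⟨g p.1, p.2⟩) fun p q hpq =>
      Subtype.ext (g.injective (congrArg Subtype.val hpq))

theorem forcingEquivalent_continuumTree_of_type
    (hcof : ((2 : Cardinal.{0}) ^ ℵ₀).ord.cof = Cardinal.aleph 1)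
    {P : Type} [Preorder P] (hn : IsNontrivial P) (hc : IsClosedForcing (Cardinal.aleph 1) P)
    (hP : #P ≤ 2 ^ ℵ₀) : ForcingEquivalent P ContinuumTree := by
  obtain ⟨Q, hQ, hQc⟩ := exists_cover_of_cof (Cardinal.cantor ℵ₀).le hP hcof
  have := hn.1
  obtain ⟨e, he⟩ := exists_isDenseEmbedding_treeNode (K := ℕ → Bool)
    hc.exists_lower_bound_toType Q hQ fun a L hL =>
      exists_refining_antichain hn hc.exists_lower_bound_nat hP L hL (Q a) (hQc a)
  exact he.forcingEquivalent

/-- The size bound makes `P` small, which reduces the claim to universe `0`. -/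
theorem forcingEquivalent_continuumTree
    (hcof : ((2 : Cardinal.{0}) ^ ℵ₀).ord.cof = Cardinal.aleph 1)
    {P : Type u} [Preorder P] (hn : IsNontrivial P) (hc : IsClosedForcing (Cardinal.aleph 1) P)
    (hP : #P ≤ 2 ^ ℵ₀) : ForcingEquivalent P ContinuumTree := by
  have hP' : Cardinal.lift.{0} #P ≤ Cardinal.lift.{u} #(ℕ → Bool) := by simpa using hP
  obtain ⟨g⟩ := Cardinal.lift_mk_le'.1 hP'
  have : Small.{0} P := small_of_injective g.injective
  have hP₀ : #(Shrink.{0} P) ≤ 2 ^ ℵ₀ :=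
    (Cardinal.mk_le_of_injective (g.injective.comp (equivShrink P).symm.injective)).trans (by simp)
  let ψ : P ≃o Shrink.{0} P := orderIsoShrink P
  exact (IsDenseEmbedding.of_orderIso ψ.symm).forcingEquivalent.trans
    (forcingEquivalent_continuumTree_of_type hcof (hn.of_orderIso ψ) (hc.of_orderIso ψ) hP₀)

/-! ### `Add(ℵ₁, 1)` satisfies the hypotheses -/

section AddOne

theorem countable_iff_mk_lt_aleph_one {α : Type u} (s : Set α) :
    s.Countable ↔ #s < Cardinal.aleph 1 := by
  rw [← Cardinal.succ_aleph0, Order.lt_succ_iff, Cardinal.le_aleph0_iff_set_countable]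

theorem AddOne.countable_dom (p : AddOne (Cardinal.aleph 1)) : {a | p.1 a ≠ none}.Countable :=
  (countable_iff_mk_lt_aleph_one _).2 p.2

theorem isNontrivial_addOne : IsNontrivial (AddOne (Cardinal.aleph 1)) := by
  classical
  refine ⟨⟨⟨fun _ => none, ?_⟩⟩, fun p => ?_⟩
  · simp
  obtain ⟨a, ha⟩ : ∃ a, p.1 a = none := by
    by_contra! h
    have : #{a // p.1 a ≠ none} = Cardinal.aleph 1 := by
      rw [Cardinal.mk_congr (Equiv.subtypeUnivEquiv h), Cardinal.mk_ord_toType]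
    exact p.2.ne this
  let q (b : Bool) : AddOne (Cardinal.aleph 1) := ⟨Function.update p.1 a (some b), by
    refine (countable_iff_mk_lt_aleph_one _).1
      ((p.countable_dom.insert a).mono fun x hx => ?_)
    by_cases hxa : x = a
    · exact Or.inl hxa
    · refine Or.inr fun hpx => hx ?_
      rw [Function.update_of_ne hxa, hpx]⟩
  have hq : ∀ b, q b ≤ p := fun b x c hx => by
    have hxa : x ≠ a := by
      rintro rfl
      simp [ha] at hx
    exact (Function.update_of_ne hxa _ _).trans hx
  have hqa : ∀ b, (q b).1 a = some b := fun b => Function.update_self _ _ _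
  refine ⟨q true, q false, hq _, hq _, ?_⟩
  rintro ⟨r, h₁, h₂⟩
  have h := (h₁ a true (hqa _)).symm.trans (h₂ a false (hqa _))
  simp at h

theorem isClosedForcing_addOne :
    IsClosedForcing (Cardinal.aleph 1) (AddOne (Cardinal.aleph 1)) := by
  classical
  intro α hα f hf
  have hαc : Countable (Iio α) := by
    have h₁ : α.card < Cardinal.aleph 1 := Cardinal.lt_ord.1 hα
    rw [← Cardinal.mk_le_aleph0_iff, Cardinal.mk_Iio_ordinal, Cardinal.lift_le_aleph0]
    rw [← Cardinal.succ_aleph0] at h₁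
    exact Order.lt_succ_iff.1 h₁
  -- This is the union of the chain; the chosen index is immaterial because members of a chain agree
  -- where both are defined.
  let g : (Cardinal.aleph.{0} 1).ord.ToType → Option Bool := fun a =>
    if h : ∃ i, (f i).1 a ≠ none then (f h.choose).1 a else none
  have hg : ∀ i a b, (f i).1 a = some b → g a = some b := by
    intro i a b hb
    have h : ∃ i, (f i).1 a ≠ none := ⟨i, by simp [hb]⟩
    obtain ⟨c, hc⟩ := Option.ne_none_iff_exists'.1 h.choose_spec
    simp only [g, dif_pos h]
    rcases le_total i h.choose with hle | hle
    · exact hf hle a b hb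
    · rw [hc, ← hb, hf hle a c hc]
  refine ⟨⟨g, (countable_iff_mk_lt_aleph_one {a | g a ≠ none}).1 ?_⟩, fun i a b => hg i a b⟩
  refine (countable_iUnion fun i => (f i).countable_dom).mono fun a ha => ?_
  by_contra h
  refine ha (dif_neg fun ⟨i, hi⟩ => h (mem_iUnion.2 ⟨i, hi⟩))

/-- A condition is determined by its graph, a countable subset of a set of size at most continuum,
and `(2 ^ ℵ₀) ^ ℵ₀ = 2 ^ ℵ₀`. -/
theorem mk_addOne_le : #(AddOne (Cardinal.aleph 1)) ≤ 2 ^ ℵ₀ := by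
  let W : Type := (Cardinal.aleph.{0} 1).ord.ToType
  let graph (p : AddOne (Cardinal.aleph 1)) : Set (W × Bool) := {x | p.1 x.1 = some x.2}
  have hgraph : ∀ p, (graph p).Countable := fun p => by
    refine (p.countable_dom.prod (to_countable (univ : Set Bool))).mono fun x hx => ?_
    have : p.1 x.1 = some x.2 := hx
    exact ⟨by simp [this], mem_univ _⟩
  have hinj : Function.Injective graph := fun p q h => Subtype.ext <| funext fun a =>
    Option.ext fun b => Set.ext_iff.1 h (a, b)
  have hWc : #(W × Bool) ≤ 2 ^ ℵ₀ := by
    rw [Cardinal.mk_prod]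
    simp only [Cardinal.lift_id, W, Cardinal.mk_ord_toType]
    refine Cardinal.mul_le_of_le (Cardinal.cantor ℵ₀).le ?_ ?_
    · exact Cardinal.aleph_one_le_continuum
    · exact Cardinal.mk_le_aleph0.trans (Cardinal.cantor ℵ₀).le
  have h₁ : #(AddOne (Cardinal.aleph 1)) ≤ #{s : Set (W × Bool) // #s ≤ ℵ₀} :=
    Cardinal.mk_le_of_injective (f := fun p => ⟨graph p, (hgraph p).le_aleph0⟩)
      fun p q h => hinj (congrArg Subtype.val h)
  refine h₁.trans ((Cardinal.mk_bounded_set_le _ _).trans ?_)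
  refine (Cardinal.power_le_power_right (max_le hWc (Cardinal.cantor ℵ₀).le)).trans ?_
  rw [← Cardinal.power_mul, Cardinal.aleph0_mul_aleph0]

end AddOne

end Forcing

end

theorem theorem1p1
    (hcof : ((2 : Cardinal.{0}) ^ Cardinal.aleph0.{0}).ord.cof = Cardinal.aleph.{0} 1)
    {P : Type*} [Preorder P]
    (hnontrivial : Forcing.IsNontrivial P)
    (hclosed : Forcing.IsClosedForcing (Cardinal.aleph 1) P)
    (hsize : Cardinal.mk P ≤ 2 ^ Cardinal.aleph0) :
    Forcing.ForcingEquivalent P (Forcing.AddOne (Cardinal.aleph 1)) :=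
  (Forcing.forcingEquivalent_continuumTree hcof hnontrivial hclosed hsize).trans
    (Forcing.forcingEquivalent_continuumTree hcof Forcing.isNontrivial_addOne
      Forcing.isClosedForcing_addOne Forcing.mk_addOne_le).symm
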